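/- **Definitions.** Let $X$ be a proper metric space; $B(x,r)$ denotes the closed ball and $\mathcal C(X)$ the set of closed subsets of $X$. An *abstract pattern space* over $X$ is a non-empty set $\Pi$ with a map $\Pi\times\mathcal C(X)\to\Pi$, $(\mathcal P,C)\mapsto\mathcal P\wedge C$, such that $(\mathcal P\wedge C_1)\wedge C_2=\mathcal P\wedge(C_1\cap C_2)$, and such that for each $\mathcal P\in\Pi$ there is a (necessarily unique) closed set $\operatorname{supp}\mathcal P$ with $\mathcal P\wedge C=\mathcal P\iff C\supset\operatorname{supp}\mathcal P$ for all $C\in\mathcal C(X)$. Write $\mathcal P\geqq\mathcal Q$ if $\mathcal P\wedge\operatorname{supp}\mathcal Q=\mathcal Q$; this is a partial order, and $\bigvee$ denotes suprema for it. A set $\Xi\subset\Pi$ is *pairwise compatible* if any two elements of $\Xi$ have a common majorant in $\Pi$, and *locally finite* if $\{\mathcal P\wedge B(x,r):\mathcal P\in\Xi\}$ is finite for all $x\in X$, $r>0$. $\Pi$ is *glueable* if every locally finite and pairwise compatible $\Xi\subset\Pi$ has a supremum and $\bigvee\{\mathcal P\wedge C:\mathcal P\in\Xi\}=(\bigvee\Xi)\wedge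 C$ for every such $\Xi$ and every $C\in\mathcal C(X)$. $\mathcal P\in\Pi$ *consists of bounded components* if there is $R>0$ such that for all $C\in\mathcal C(X)$ and $x\in\operatorname{supp}(\mathcal P\wedge C)$ one has $x\in\operatorname{supp}(\mathcal P\wedge C\wedge B(x,R))$. If a group $\Gamma$ acts on $X$ by isometries, an abstract pattern space *over $(X,\Gamma)$* is an abstract pattern space $\Pi$ over $X$ with an action of $\Gamma$ such that $(\gamma\mathcal P)\wedge(\gamma C)=\gamma(\mathcal P\wedge C)$. For $\mathcal P_1,\mathcal P_2$ in abstract pattern spaces over $(X,\Gamma)$ and $(Y,\Gamma)$, $\mathcal P_2$ is *locally derivable* from $\mathcal P_1$ if there are $x_0\in X$, $y_0\in Y$, $R_0\geq 0$ such that for all $\gamma,\eta\in\Gamma$ and $R\geq 0$, $(\gamma\mathcal P_1)\wedge B(x_0,R+R_0)=(\eta\mathcal P_1)\wedge B(x_0,R+R_0)$ implies $(\gamma\mathcal P_2)\wedge B(y_0,R)=(\eta\mathcal P_2)\wedge B(y_0,R)$. They are *mutually locally derivable (MLD)* if each is locally derivable from the other. A *Delone set* in $X$ is a subset that is uniformly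 discrete (for some $r>0$, distinct points are at distance $>r$) and relatively dense (for some $R>0$, every ball of radius $R$ contains a point of it). Delone sets are regarded as elements of the abstract pattern space over $(X,\Gamma)$ of all uniformly discrete subsets of $X$, with $D\wedge C=D\cap C$ and $\gamma D=\{\gamma x:x\in D\}$. An abstract pattern is *Delone-deriving* if some Delone set in $X$ is locally derivable from it. **Corollary.** Let $d\geq 1$, and let $\Gamma$ be a closed subgroup of the group $\mathrm E(d)=\mathbb R^d\rtimes\mathrm O(d)$ of all isometries of the Euclidean space $\mathbb R^d$ that contains all translations; here $\mathrm E(d)$ carries the metric $\rho((a,A),(b,B))=\|a-b\|+\|A-B\|$ (Euclidean norm plus operator norm). Let $\Pi$ be a glueable abstract pattern space over $(\mathbb R^d,\Gamma)$ and let $\mathcal P\in\Pi$ consist of bounded components and be Delone-deriving. Then there is a Delone set $D$ in $\mathbb R^d$ such that $\mathcal P$ and $D$ are MLD (with respect to $\Gamma$). (When $\Gamma$ is larger than the group of translations, this relation is what is called S-MLD.) -/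

import Mathlib

open TopologicalSpace Metric
open scoped NNReal

universe u v w

/-! ### Abstract pattern spaces -/

/-- An abstract pattern space over `X`: a nonempty set `Pat` with a cutting-off operation
`(P, C) ↦ P ∧ C` for `C` closed in `X`, such that `(P ∧ C₁) ∧ C₂ = P ∧ (C₁ ∩ C₂)`, and such that
every `P` has a support, i.e. a closed set `S` with `P ∧ C = P ↔ S ⊆ C` for all closed `C`. -/
class AbstractPatternSpace (X : Type u) [TopologicalSpace X] (Pat : Type v) where
  nonempty : Nonempty Pat
  cut : Pat → Closeds X → Pat
  cut_cut : ∀ (P : Pat) (C₁ C₂ : Closeds X), cut (cut P C₁) C₂ = cut P (C₁ ⊓ C₂)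
  exists_supp : ∀ P : Pat, ∃ S : Closeds X, ∀ C : Closeds X, cut P C = P ↔ S ≤ C

namespace AbstractPatternSpace

section Order

variable (X : Type u) [TopologicalSpace X] {Pat : Type v} [AbstractPatternSpace X Pat]

/-- The support of an abstract pattern. -/
noncomputable def supp (P : Pat) : Closeds X := Classical.choose (exists_supp (X := X) P)

theorem cut_eq_self_iff (P : Pat) (C : Closeds X) : cut P C = P ↔ supp X P ≤ C :=
  Classical.choose_spec (exists_supp (X := X) P) C

/-- The order on abstract patterns: `P ≧ Q` iff `P ∧ supp Q = Q`. -/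
def Majorizes (P Q : Pat) : Prop := cut P (supp X Q) = Q

/-- `S` is the supremum of the set `Ξ` of abstract patterns for the order `Majorizes`. -/
def IsSupremum (Ξ : Set Pat) (S : Pat) : Prop :=
  (∀ P ∈ Ξ, Majorizes X S P) ∧ ∀ T : Pat, (∀ P ∈ Ξ, Majorizes X T P) → Majorizes X T S

/-- Any two elements of `Ξ` have a common majorant in the whole space. -/
def PairwiseCompatible (Ξ : Set Pat) : Prop :=
  ∀ P ∈ Ξ, ∀ Q ∈ Ξ, ∃ R : Pat, Majorizes X R P ∧ Majorizes X R Q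

end Order

/-- The closed ball `B(x, r)`, as a closed set. -/
def closedBallC {X : Type u} [PseudoMetricSpace X] (x : X) (r : ℝ) : Closeds X :=
  ⟨closedBall x r, isClosed_closedBall⟩

section Metric

variable (X : Type u) [MetricSpace X] {Pat : Type v} [AbstractPatternSpace X Pat]

/-- `Ξ` is locally finite: for every closed ball `B`, the set `{P ∧ B | P ∈ Ξ}` is finite. -/
def LocallyFinitePatterns (Ξ : Set Pat) : Prop :=
  ∀ (x : X) (r : ℝ), 0 < r → ((fun P => cut P (closedBallC x r)) '' Ξ).Finite

variable (Pat) in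
/-- An abstract pattern space is glueable if every locally finite and pairwise compatible set `Ξ`
has a supremum, and `⋁ {P ∧ C | P ∈ Ξ} = (⋁ Ξ) ∧ C` for all such `Ξ` and all closed `C`. -/
def Glueable : Prop :=
  (∀ Ξ : Set Pat, LocallyFinitePatterns X Ξ → PairwiseCompatible X Ξ →
      ∃ S : Pat, IsSupremum X Ξ S) ∧
  (∀ Ξ : Set Pat, LocallyFinitePatterns X Ξ → PairwiseCompatible X Ξ →
      ∀ (C : Closeds X) (S : Pat), IsSupremum X Ξ S →
        IsSupremum X ((fun P => cut P C) '' Ξ) (cut S C))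

/-- `P` consists of bounded components: there is `R > 0` such that for every closed `C` and
every `x ∈ supp (P ∧ C)` one has `x ∈ supp (P ∧ C ∧ B(x, R))`. -/
def ConsistsOfBoundedComponents (P : Pat) : Prop :=
  ∃ R : ℝ, 0 < R ∧ ∀ (C : Closeds X) (x : X), x ∈ supp X (cut P C) →
    x ∈ supp X (cut (cut P C) (closedBallC x R))

end Metric

end AbstractPatternSpace

/-! ### Group actions and local derivability -/

/-- The image `γ C` of a closed set under the action of a group element. -/
def smulClosed {Γ : Type w} {X : Type u} [Group Γ] [TopologicalSpace X] [MulAction Γ X]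
    [ContinuousConstSMul Γ X] (γ : Γ) (C : Closeds X) : Closeds X :=
  ⟨(fun x => γ • x) '' (C : Set X), (isClosedMap_smul γ) _ C.isClosed⟩

/-- An abstract pattern space over `(X, Γ)`: the cutting-off operation is `Γ`-equivariant,
`(γ P) ∧ (γ C) = γ (P ∧ C)`. -/
class EquivariantPatternSpace (Γ : Type w) (X : Type u) (Pat : Type v) [Group Γ]
    [TopologicalSpace X] [MulAction Γ X] [ContinuousConstSMul Γ X] [AbstractPatternSpace X Pat]
    [MulAction Γ Pat] : Prop where
  smul_cut_smul : ∀ (γ : Γ) (P : Pat) (C : Closeds X),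
    AbstractPatternSpace.cut (γ • P) (smulClosed γ C) = γ • AbstractPatternSpace.cut P C

namespace AbstractPatternSpace

/-- `P₂`, an abstract pattern over `(Y, Γ)`, is locally derivable from `P₁`, an abstract pattern
over `(X, Γ)`. -/
def LocallyDerivable (Γ : Type*) (X Y : Type*) {Pat₁ Pat₂ : Type*} [Group Γ]
    [MetricSpace X] [MulAction Γ X] [IsIsometricSMul Γ X]
    [MetricSpace Y] [MulAction Γ Y] [IsIsometricSMul Γ Y]
    [AbstractPatternSpace X Pat₁] [MulAction Γ Pat₁] [EquivariantPatternSpace Γ X Pat₁]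
    [AbstractPatternSpace Y Pat₂] [MulAction Γ Pat₂] [EquivariantPatternSpace Γ Y Pat₂]
    (P₁ : Pat₁) (P₂ : Pat₂) : Prop :=
  ∃ (x₀ : X) (y₀ : Y) (R₀ : ℝ), 0 ≤ R₀ ∧ ∀ (γ η : Γ) (R : ℝ), 0 ≤ R →
    cut (γ • P₁) (closedBallC x₀ (R + R₀)) = cut (η • P₁) (closedBallC x₀ (R + R₀)) →
    cut (γ • P₂) (closedBallC y₀ R) = cut (η • P₂) (closedBallC y₀ R)

/-- Mutual local derivability. -/
def MutuallyLocallyDerivable (Γ : Type*) (X Y : Type*) {Pat₁ Pat₂ : Type*} [Group Γ]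
    [MetricSpace X] [MulAction Γ X] [IsIsometricSMul Γ X]
    [MetricSpace Y] [MulAction Γ Y] [IsIsometricSMul Γ Y]
    [AbstractPatternSpace X Pat₁] [MulAction Γ Pat₁] [EquivariantPatternSpace Γ X Pat₁]
    [AbstractPatternSpace Y Pat₂] [MulAction Γ Pat₂] [EquivariantPatternSpace Γ Y Pat₂]
    (P₁ : Pat₁) (P₂ : Pat₂) : Prop :=
  LocallyDerivable Γ X Y P₁ P₂ ∧ LocallyDerivable Γ Y X P₂ P₁

end AbstractPatternSpace

/-! ### The space `UD(X)` of uniformly discrete sets -/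

/-- The uniformly discrete subsets of a metric space: for some `r > 0`, any two distinct points
are at distance `> r`. -/
@[ext] structure UDSet (X : Type u) [MetricSpace X] where
  carrier : Set X
  uniformlyDiscrete : ∃ r : ℝ≥0, 0 < r ∧ IsSeparated (r : ENNReal) carrier

namespace UDSet

variable {X : Type u} [MetricSpace X]

/-- `UD(X)` is an abstract pattern space over `X`, cutting off being the intersection. -/
instance : AbstractPatternSpace X (UDSet X) where
  nonempty := ⟨⟨∅, 1, one_pos, by simp [IsSeparated]⟩⟩
  cut D C := ⟨D.carrier ∩ C, by
    obtain ⟨r, hr, h⟩ := D.uniformlyDiscrete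
    exact ⟨r, hr, h.mono Set.inter_subset_left⟩⟩
  cut_cut D C₁ C₂ := UDSet.ext (by simp [Set.inter_assoc])
  exists_supp D := ⟨⟨closure D.carrier, isClosed_closure⟩, fun C => by
    rw [UDSet.ext_iff]
    change D.carrier ∩ C = D.carrier ↔ closure D.carrier ⊆ C
    rw [Set.inter_eq_left, C.isClosed.closure_subset_iff]⟩

variable {Γ : Type w} [Group Γ] [MulAction Γ X] [IsIsometricSMul Γ X]

/-- `Γ` acts on `UD(X)` by taking images. -/
instance : MulAction Γ (UDSet X) where
  smul γ D := ⟨(fun x => γ • x) '' D.carrier, by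
    obtain ⟨r, hr, h⟩ := D.uniformlyDiscrete
    refine ⟨r, hr, ?_⟩
    rintro _ ⟨x, hx, rfl⟩ _ ⟨y, hy, rfl⟩ hxy
    have := h hx hy (fun e => hxy (by rw [e]))
    simpa only [edist_smul_left] using this⟩
  one_smul D := UDSet.ext (by
    change (fun x => (1 : Γ) • x) '' D.carrier = D.carrier
    simp)
  mul_smul γ η D := UDSet.ext (by
    change (fun x => (γ * η) • x) '' D.carrier = (fun x => γ • x) '' ((fun x => η • x) '' D.carrier)
    rw [Set.image_image]
    simp only [mul_smul])

instance : EquivariantPatternSpace Γ X (UDSet X) where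
  smul_cut_smul γ D C := UDSet.ext (by
    change (fun x => γ • x) '' D.carrier ∩ (fun x => γ • x) '' (C : Set X) =
      (fun x => γ • x) '' (D.carrier ∩ C)
    exact (Set.image_inter (MulAction.injective γ)).symm)

end UDSet

/-- A Delone set, regarded as an element of `UD(X)`. -/
def Delone.DeloneSet.toUD {X : Type u} [MetricSpace X] (D : Delone.DeloneSet X) : UDSet X :=
  ⟨D.carrier, D.packingRadius, D.packingRadius_pos, D.isSeparated_packingRadius⟩

/-- `P` is Delone-deriving: some Delone set in `X` is locally derivable from `P`. -/
def AbstractPatternSpace.DeloneDeriving (Γ : Type*) (X : Type*) {Pat : Type*} [Group Γ]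
    [MetricSpace X] [MulAction Γ X] [IsIsometricSMul Γ X]
    [AbstractPatternSpace X Pat] [MulAction Γ Pat] [EquivariantPatternSpace Γ X Pat]
    (P : Pat) : Prop :=
  ∃ D : Delone.DeloneSet X, LocallyDerivable Γ X X P D.toUD

/-! ### The Euclidean group `E(d)` -/

/-- The group `E(d)` of all isometries of `ℝ^d`. -/
abbrev EuclideanGroup (d : ℕ) : Type :=
  EuclideanSpace ℝ (Fin d) ≃ᵢ EuclideanSpace ℝ (Fin d)

namespace EuclideanGroup

variable {d : ℕ}

/-- `E(d)` acts on `ℝ^d` by evaluation. -/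
noncomputable instance : MulAction (EuclideanGroup d) (EuclideanSpace ℝ (Fin d)) where
  smul γ x := γ x
  one_smul _ := rfl
  mul_smul _ _ _ := rfl

instance : IsIsometricSMul (EuclideanGroup d) (EuclideanSpace ℝ (Fin d)) where
  isometry_smul γ := γ.isometry

instance (Γ : Subgroup (EuclideanGroup d)) : IsIsometricSMul Γ (EuclideanSpace ℝ (Fin d)) where
  isometry_smul γ := γ.1.isometry

/-- The linear part `A ∈ O(d)` of the isometry `x ↦ A x + a`, as a continuous linear map. -/
noncomputable def linearPart (γ : EuclideanGroup d) :
    EuclideanSpace ℝ (Fin d) →L[ℝ] EuclideanSpace ℝ (Fin d) :=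
  γ.toRealAffineIsometryEquiv.linearIsometryEquiv.toContinuousLinearEquiv

/-- The metric on `E(d)`: `ρ((a, A), (b, B)) = ‖a - b‖ + ‖A - B‖` (operator norm), where
`(a, A)` stands for the isometry `x ↦ A x + a`, so that `a` is the image of `0`. -/
noncomputable def euclideanDist (γ η : EuclideanGroup d) : ℝ :=
  dist (γ 0) (η 0) + ‖linearPart γ - linearPart η‖

/-- `Γ` is a closed subset of `E(d)` for the metric `euclideanDist`. -/
def IsClosedSubgroup (Γ : Subgroup (EuclideanGroup d)) : Prop :=
  ∀ γ : EuclideanGroup d, (∀ ε : ℝ, 0 < ε → ∃ η ∈ Γ, euclideanDist γ η < ε) → γ ∈ Γ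

/-- `Γ` contains all the translations `x ↦ v + x`. -/
def ContainsTranslations (Γ : Subgroup (EuclideanGroup d)) : Prop :=
  ∀ v : EuclideanSpace ℝ (Fin d), IsometryEquiv.constVAdd v ∈ Γ

end EuclideanGroup

/-! Let `D₀` be a Delone set locally derivable from `P`. The isometries in `Γ` carrying one point of
`D₀` to another together with the patches of `P` of a large radius `R₁` around them form a groupoid
`T` (`patchMaps`). The plan is to replace each point of `D₀` by a tiny finite cluster recording its
orbit and orientation under `T`.

Since `P` determines `D₀` locally, isotropy elements of `T` map nearby points of `D₀` into `D₀`.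
Distinct ones are therefore uniformly separated as operators, and a compactness argument puts near
each point of `D₀` a base point that all nontrivial isotropy moves by a uniform amount
(`exists_uniformly_moved_point`). At the base point of an orbit representative sits a small copy of
a rigid finite set (`exists_rigid_finite_set`), its scale an injective code for the orbit; all
elements of `T` transport it. The union `D` is Delone, and an isometry mapping `D` near `x` into `D`
must map a copy onto a copy of equal scale, hence lies in `T` (`exists_encoding`).

So `P` determines `D` locally. Conversely, a local coincidence of two images of `D` yields
coincidences of patches of `P`, and these glue because the components of `P` are bounded
(`Glueable.isSupremum_cut_closedBall`). -/

open scoped RealInnerProductSpace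

/-! ### Common vectors for families of operators -/

section Separated

variable {E : Type*} [NormedAddCommGroup E] [NormedSpace ℝ E]

/-- Finitely many nonzero operators have a common vector, in the unit ball, outside all kernels. -/
theorem exists_common_vector_of_ne_zero {ι : Type*} [Finite ι] (A : ι → E →L[ℝ] E)
    (hA : ∀ i, A i ≠ 0) : ∃ u : E, ‖u‖ ≤ 1 ∧ ∀ i, A i u ≠ 0 := by
  have h : ∃ u : E, ∀ i, A i u ≠ 0 := by
    by_contra! hcon
    -- A real vector space is not a finite union of proper subspaces.
    have hcov : ⋃ i, (((A i).toLinearMap.ker : Submodule ℝ E) : Set E) = Set.univ := by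
      ext u
      obtain ⟨i, hi⟩ := hcon u
      simpa using ⟨i, hi⟩
    obtain ⟨i, hi⟩ := Subspace.exists_eq_top_of_iUnion_eq_univ hcov
    apply hA i
    ext1 u
    have : u ∈ (A i).toLinearMap.ker := by rw [hi]; trivial
    simpa using this
  obtain ⟨u, hu⟩ := h
  refine ⟨(1 + ‖u‖)⁻¹ • u, ?_, fun i => ?_⟩
  · rw [norm_smul, norm_inv, Real.norm_of_nonneg (by positivity), inv_mul_le_iff₀ (by positivity)]
    linarith
  · rw [map_smul]
    exact smul_ne_zero (by positivity) (hu i)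

variable [FiniteDimensional ℝ E]

/-- Compactness of the set of admissible tuples: a vector outside the kernels of one tuple works,
with a fixed constant, for all nearby tuples. -/
theorem exists_uniform_common_vector (ι : Type*) [Finite ι] {κ : ℝ} (hκ : 0 < κ) (M : ℝ) :
    ∃ c : ℝ, 0 < c ∧ ∀ A : ι → E →L[ℝ] E, (∀ i, κ ≤ ‖A i‖) → (∀ i, ‖A i‖ ≤ M) →
      ∃ u : E, ‖u‖ ≤ 1 ∧ ∀ i, c ≤ ‖A i u‖ := by
  have := Fintype.ofFinite ι
  let S : Set (ι → E →L[ℝ] E) := {A | (∀ i, κ ≤ ‖A i‖) ∧ ∀ i, ‖A i‖ ≤ M}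
  have hS : IsCompact S := by
    have hcl : IsClosed S := by
      have : S = (⋂ i, {A | κ ≤ ‖A i‖}) ∩ ⋂ i, {A | ‖A i‖ ≤ M} := by
        ext A; simp [S]
      rw [this]
      exact (isClosed_iInter fun i => isClosed_le (by fun_prop) (by fun_prop)).inter
        (isClosed_iInter fun i => isClosed_le (by fun_prop) (by fun_prop))
    refine (isCompact_univ_pi (fun _ : ι => isCompact_closedBall (0 : E →L[ℝ] E) M)).of_isClosed_subset
      hcl fun A hA i _ => ?_
    simpa using hA.2 i
  suffices h : ∃ c : ℝ, 0 < c ∧ ∀ A ∈ S, ∃ u : E, ‖u‖ ≤ 1 ∧ ∀ i, c ≤ ‖A i u‖ by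
    obtain ⟨c, hc, h⟩ := h
    exact ⟨c, hc, fun A h₁ h₂ => h A ⟨h₁, h₂⟩⟩
  refine hS.induction_on (p := fun s => ∃ c : ℝ, 0 < c ∧ ∀ A ∈ s, ∃ u : E, ‖u‖ ≤ 1 ∧
    ∀ i, c ≤ ‖A i u‖) ⟨1, one_pos, by simp⟩ ?_ ?_ ?_
  · rintro s t hst ⟨c, hc, h⟩
    exact ⟨c, hc, fun A hA => h A (hst hA)⟩
  · rintro s t ⟨c, hc, h⟩ ⟨c', hc', h'⟩
    refine ⟨min c c', lt_min hc hc', ?_⟩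
    rintro A (hA | hA)
    · obtain ⟨u, hu, hu'⟩ := h A hA
      exact ⟨u, hu, fun i => (min_le_left _ _).trans (hu' i)⟩
    · obtain ⟨u, hu, hu'⟩ := h' A hA
      exact ⟨u, hu, fun i => (min_le_right _ _).trans (hu' i)⟩
  · intro A hA
    obtain ⟨u, hu, hAu⟩ := exists_common_vector_of_ne_zero A fun i h0 => by
      have := hA.1 i
      rw [h0, norm_zero] at this
      linarith
    obtain ⟨c, hc, hcA⟩ : ∃ c : ℝ, 0 < c ∧ ∀ i, c < ‖A i u‖ := by
      cases isEmpty_or_nonempty ι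
      · exact ⟨1, one_pos, isEmptyElim⟩
      · obtain ⟨j, hj⟩ := Finite.exists_min fun i => ‖A i u‖
        have hpos := norm_pos_iff.2 (hAu j)
        exact ⟨‖A j u‖ / 2, half_pos hpos, fun i => (half_lt_self hpos).trans_le (hj i)⟩
    have hopen : IsOpen (⋂ i, {B : ι → E →L[ℝ] E | c < ‖B i u‖}) :=
      isOpen_iInter_of_finite fun i => isOpen_lt (by fun_prop) (by fun_prop)
    exact ⟨_, mem_nhdsWithin_of_mem_nhds (hopen.mem_nhds (by simpa using hcA)), c, hc,
      fun B hB => ⟨u, hu, fun i => (Set.mem_iInter.1 hB i).le⟩⟩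

/-- Operators that are uniformly separated, bounded and bounded away from `0` have a common
vector which they all keep away from `0`, uniformly in the family. -/
theorem exists_uniform_common_vector_of_separated {κ : ℝ} (hκ : 0 < κ) (M : ℝ) :
    ∃ c : ℝ, 0 < c ∧ ∀ S : Set (E →L[ℝ] E), (∀ A ∈ S, κ ≤ ‖A‖) → (∀ A ∈ S, ‖A‖ ≤ M) →
      (∀ A ∈ S, ∀ B ∈ S, A ≠ B → κ ≤ ‖A - B‖) → ∃ u : E, ‖u‖ ≤ 1 ∧ ∀ A ∈ S, c ≤ ‖A u‖ := by
  -- A ball of radius `κ / 2` contains at most one member of `S`, so the finite cover `t` indexes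
  -- every such family; cells without a member are filled with an arbitrary `A₀`.
  obtain ⟨t, -, htfin, ht⟩ := finite_cover_balls_of_compact
    (isCompact_closedBall (0 : E →L[ℝ] E) M) (half_pos hκ)
  have : Finite t := htfin
  obtain ⟨c, hc, h⟩ := exists_uniform_common_vector (E := E) t hκ M
  refine ⟨c, hc, fun S hS₁ hS₂ hS₃ => ?_⟩
  obtain rfl | ⟨A₀, hA₀⟩ := S.eq_empty_or_nonempty
  · exact ⟨0, by simp, by simp⟩
  have hex : ∀ z : t, ∃ A ∈ S, ∀ B ∈ S, B ∈ ball (z : E →L[ℝ] E) (κ / 2) → A = B := by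
    intro z
    by_cases hz : ∃ A ∈ S, A ∈ ball (z : E →L[ℝ] E) (κ / 2)
    · obtain ⟨A, hA, hAz⟩ := hz
      refine ⟨A, hA, fun B hB hBz => ?_⟩
      by_contra hne
      have h₁ := hS₃ A hA B hB hne
      have h₂ := dist_triangle_right A B z
      rw [mem_ball] at hAz hBz
      rw [← dist_eq_norm] at h₁
      linarith
    · push Not at hz
      exact ⟨A₀, hA₀, fun B hB hBz => absurd hBz (hz B hB)⟩
  choose f hfS hf using hex
  obtain ⟨u, hu, hcu⟩ := h f (fun z => hS₁ _ (hfS z)) (fun z => hS₂ _ (hfS z))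
  refine ⟨u, hu, fun A hA => ?_⟩
  obtain ⟨z, hz, hAz⟩ := Set.mem_iUnion₂.1 (ht (mem_closedBall_zero_iff.2 (hS₂ A hA)))
  rw [← hf ⟨z, hz⟩ A hA hAz]
  exact hcu _

end Separated

/-! ### Finite sets without nontrivial self-similarities -/

section Rigid

/-- A scaling self-map of a finite set with at least two points has scaling factor `1`. -/
theorem scaling_eq_one_of_mapsTo_finite {X : Type*} [MetricSpace X] {K : Set X} (hK : K.Finite)
    (hK' : K.Nontrivial) {f : X → X} {l : ℝ} (hl : 0 < l) (hf : Set.MapsTo f K K)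
    (hdist : ∀ k ∈ K, ∀ k' ∈ K, dist (f k) (f k') = l * dist k k') :
    l = 1 ∧ Set.SurjOn f K K := by
  have hinj : Set.InjOn f K := by
    intro k hk k' hk' h
    have h' := hdist k hk k' hk'
    rw [h, dist_self] at h'
    exact dist_eq_zero.1 (by simpa [hl.ne'] using h'.symm)
  have hsurj : Set.SurjOn f K K := ((hK.injOn_iff_bijOn_of_mapsTo hf).1 hinj).surjOn
  refine ⟨?_, hsurj⟩
  -- The images of a pair at maximal distance give `l ≤ 1`, its preimages give `l ≥ 1`.
  obtain ⟨⟨a, b⟩, ⟨ha, hb⟩, hmax⟩ := Set.exists_max_image (K ×ˢ K) (fun p => dist p.1 p.2)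
    (hK.prod hK) (hK'.nonempty.prod hK'.nonempty)
  simp only [Set.mem_prod, and_imp, Prod.forall] at hmax ha hb
  have hpos : 0 < dist a b := by
    obtain ⟨p, hp, q, hq, hpq⟩ := hK'
    exact (dist_pos.2 hpq).trans_le (hmax p q hp hq)
  have h₁ : l * dist a b ≤ dist a b := by
    rw [← hdist a ha b hb]
    exact hmax _ _ (hf ha) (hf hb)
  obtain ⟨a', ha', rfl⟩ := hsurj ha
  obtain ⟨b', hb', rfl⟩ := hsurj hb
  have h₂ := hmax a' b' ha' hb'
  have h₃ := hdist a' ha' b' hb'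
  apply le_antisymm
  · nlinarith
  · by_contra! hlt
    nlinarith

/-- Take `0`, the standard basis and the vector `v = (10, 11, 12, …)`. Being far from the other
points, which are close together, `v` is fixed; its distances to the others are pairwise distinct,
so these are fixed too. -/
theorem exists_rigid_finite_set {d : ℕ} (hd : 0 < d) :
    ∃ K : Set (EuclideanSpace ℝ (Fin d)), K.Finite ∧ K.Nontrivial ∧ 0 ∈ K ∧
      (∀ n : EuclideanSpace ℝ (Fin d), n ≠ 0 → ∃ k ∈ K, ⟪n, k⟫ ≠ 0) ∧
      ∀ (f : EuclideanSpace ℝ (Fin d) → EuclideanSpace ℝ (Fin d)) (l : ℝ), 0 < l →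
        Set.MapsTo f K K → (∀ k ∈ K, ∀ k' ∈ K, dist (f k) (f k') = l * dist k k') →
        l = 1 ∧ ∀ k ∈ K, f k = k := by
  classical
  let e : Fin d → EuclideanSpace ℝ (Fin d) := fun i => EuclideanSpace.single i 1
  let v : EuclideanSpace ℝ (Fin d) := WithLp.toLp 2 fun i => (i : ℝ) + 10
  let S : Set (EuclideanSpace ℝ (Fin d)) := insert 0 (Set.range e)
  let i₀ : Fin d := ⟨0, hd⟩
  have hvn : 100 ≤ ‖v‖ ^ 2 := by
    rw [EuclideanSpace.norm_sq_eq]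
    refine le_trans ?_ (Finset.single_le_sum (fun i _ => by positivity) (Finset.mem_univ i₀))
    simp only [v, Real.norm_eq_abs, sq_abs]
    have : (0 : ℝ) ≤ (i₀ : ℕ) := by positivity
    nlinarith
  have hvn' : 10 ≤ ‖v‖ := by nlinarith [norm_nonneg v]
  have hen : ∀ i, ‖e i‖ = 1 := fun i => by simp [e]
  have hS1 : ∀ p ∈ S, ‖p‖ ≤ 1 := by
    rintro p (rfl | ⟨i, rfl⟩)
    · simp
    · exact (hen i).le
  have hve : ∀ i, dist v (e i) ^ 2 = ‖v‖ ^ 2 - 2 * ((i : ℝ) + 10) + 1 := by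
    intro i
    have : ⟪v, e i⟫ = (i : ℝ) + 10 := by
      simp [e, v, EuclideanSpace.inner_single_right]
    rw [dist_eq_norm, norm_sub_sq_real, hen, this]
    ring
  have hfar : ∀ p ∈ S, 9 ≤ dist v p := by
    intro p hp
    have h₁ := norm_sub_norm_le v p
    rw [dist_eq_norm]
    linarith [hS1 p hp]
  have hnear : ∀ p ∈ S, ∀ q ∈ S, dist p q ≤ 2 := by
    intro p hp q hq
    rw [dist_eq_norm]
    linarith [norm_sub_le p q, hS1 p hp, hS1 q hq]
  have hdistinct : ∀ p ∈ S, ∀ q ∈ S, dist v p = dist v q → p = q := by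
    have h0 : ∀ i : Fin d, (0 : ℝ) ≤ (i : ℕ) := fun i => by positivity
    rintro p (rfl | ⟨i, rfl⟩) q (rfl | ⟨j, rfl⟩) h
    · rfl
    · have h' := hve j
      rw [← h, dist_zero_right] at h'
      linarith [h0 j]
    · have h' := hve i
      rw [h, dist_zero_right] at h'
      linarith [h0 i]
    · have h' := hve i
      rw [h, hve j] at h'
      have : (i : ℝ) = j := by linarith
      rw [Fin.ext (Nat.cast_injective this)]
  have hSpair : ∀ p ∈ S, ∃ q ∈ S, q ≠ p := by
    intro p hp
    by_cases h : p = 0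
    · refine ⟨e i₀, Or.inr ⟨i₀, rfl⟩, ?_⟩
      rw [h, ← norm_ne_zero_iff, hen]
      exact one_ne_zero
    · exact ⟨0, Or.inl rfl, Ne.symm h⟩
  have hvS : v ∉ S := fun h => by linarith [hS1 v h]
  have h0S : (0 : EuclideanSpace ℝ (Fin d)) ∈ S := Or.inl rfl
  have hKfin : (insert v S).Finite := ((Set.finite_range e).insert 0).insert v
  have hKnt : (insert v S).Nontrivial :=
    ⟨v, Or.inl rfl, 0, Or.inr h0S, fun h => hvS (h ▸ h0S)⟩
  refine ⟨insert v S, hKfin, hKnt, Or.inr h0S, ?_, ?_⟩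
  · intro n hn
    by_contra! hcon
    apply hn
    ext i
    simpa [e, EuclideanSpace.inner_single_right] using hcon (e i) (Or.inr (Or.inr ⟨i, rfl⟩))
  · intro f l hl hf hdist
    obtain ⟨rfl, hsurj⟩ := scaling_eq_one_of_mapsTo_finite hKfin hKnt hl hf hdist
    simp only [one_mul] at hdist
    refine ⟨rfl, ?_⟩
    have hfv : f v = v := by
      obtain ⟨p, hp, hpv⟩ := hsurj (Or.inl rfl : v ∈ insert v S)
      obtain rfl | hpS := hp
      · exact hpv
      · exfalso
        obtain ⟨q, hq, hqp⟩ := hSpair p hpS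
        have h₁ := hdist p (Or.inr hpS) q (Or.inr hq)
        have h₂ := hnear p hpS q hq
        rw [hpv] at h₁
        obtain h | h := hf (Or.inr hq : q ∈ insert v S)
        · rw [h, dist_self] at h₁
          exact hqp (dist_eq_zero.1 h₁.symm).symm
        · linarith [hfar _ h]
    rintro p (rfl | hp)
    · exact hfv
    · have h₁ := hdist v (Or.inl rfl) p (Or.inr hp)
      rw [hfv] at h₁
      obtain h | h := hf (Or.inr hp : p ∈ insert v S)
      · rw [h, dist_self] at h₁
        linarith [hfar p hp]
      · exact hdistinct _ h _ hp h₁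

end Rigid

/-! ### Isometries determined by a Delone set -/

section Isometries

variable {E : Type*} [NormedAddCommGroup E] [InnerProductSpace ℝ E]

/-- The linear part of an isometry of a Euclidean space, as a continuous linear map. -/
noncomputable def IsometryEquiv.linearMap (g : E ≃ᵢ E) : E →L[ℝ] E :=
  g.toRealAffineIsometryEquiv.linearIsometryEquiv.toContinuousLinearEquiv

theorem IsometryEquiv.linearMap_sub (g : E ≃ᵢ E) (p x : E) : g.linearMap (p - x) = g p - g x := by
  have := g.toRealAffineIsometryEquiv.map_vsub p x
  simpa [IsometryEquiv.linearMap] using this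

theorem IsometryEquiv.norm_linearMap_apply (g : E ≃ᵢ E) (p : E) : ‖g.linearMap p‖ = ‖p‖ := by
  have := g.linearMap_sub p 0
  rw [sub_zero] at this
  rw [this, ← dist_eq_norm, g.dist_eq, dist_zero_right]

/-- A Delone set spans from each point `x`, already within a bounded distance of `x`. -/
theorem Delone.DeloneSet.exists_inner_sub_ne_zero (D : Delone.DeloneSet E) (x n : E) (hn : n ≠ 0) :
    ∃ p ∈ D, dist p x ≤ 2 * D.coveringRadius + 1 ∧ ⟪n, p - x⟫ ≠ 0 := by
  set R : ℝ := (D.coveringRadius : ℝ)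
  have hR : 0 ≤ R := D.coveringRadius.coe_nonneg
  have hn' : 0 < ‖n‖ := norm_pos_iff.2 hn
  -- A point of `D` within `R` of `x + w` has inner product with `n`, relative to `x`, at least `(R
  -- + 1)‖n‖ - R‖n‖ > 0`.
  set w : E := ((R + 1) * ‖n‖⁻¹) • n
  have hw : ‖w‖ = R + 1 := by
    rw [norm_smul, norm_mul, norm_inv, norm_norm, Real.norm_of_nonneg (by linarith)]
    field_simp
  obtain ⟨p, hp, hpd⟩ := D.exists_dist_le_coveringRadius (x + w)
  refine ⟨p, hp, ?_, ?_⟩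
  · have h₁ := dist_triangle_left p x (x + w)
    have h₂ : dist (x + w) x = R + 1 := by simp [hw]
    linarith
  · have h₁ : p - x = w - (x + w - p) := by abel
    have h₂ : ⟪n, w⟫ = (R + 1) * ‖n‖ := by
      rw [inner_smul_right, real_inner_self_eq_norm_sq]
      field_simp
    have h₃ : ⟪n, x + w - p⟫ ≤ ‖n‖ * R :=
      (real_inner_le_norm _ _).trans (by rw [← dist_eq_norm]; gcongr)
    rw [h₁, inner_sub_right, h₂]
    nlinarith

variable [FiniteDimensional ℝ E]

/-- Two isometries agreeing at `x` and on a set that spans from `x` are equal. -/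
theorem IsometryEquiv.eq_of_eqOn {g h : E ≃ᵢ E} {x : E} (hx : g x = h x) {T : Set E}
    (hT : ∀ p ∈ T, g p = h p) (hspan : ∀ n : E, n ≠ 0 → ∃ p ∈ T, ⟪n, p - x⟫ ≠ 0) : g = h := by
  have hker : (g.linearMap - h.linearMap).toLinearMap.ker = ⊤ := by
    by_contra hne
    rw [← Submodule.orthogonal_eq_bot_iff.not] at hne
    obtain ⟨n, hn, hn0⟩ := Submodule.exists_mem_ne_zero_of_ne_bot hne
    obtain ⟨p, hp, hpn⟩ := hspan n hn0
    apply hpn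
    rw [real_inner_comm]
    refine (Submodule.mem_orthogonal _ _).1 hn (p - x) ?_
    simp [IsometryEquiv.linearMap_sub, hx, hT p hp]
  ext1 p
  have : p - x ∈ (g.linearMap - h.linearMap).toLinearMap.ker := by rw [hker]; trivial
  simp only [LinearMap.mem_ker, ContinuousLinearMap.coe_coe, sub_apply,
    IsometryEquiv.linearMap_sub, hx] at this
  exact sub_eq_zero.1 (by simpa using this)

/-- Near every point `x` of a Delone set there is a point which is moved by a definite amount by
all nontrivial isometries fixing `x` and preserving the Delone set near `x`. -/
theorem Delone.DeloneSet.exists_uniformly_moved_point (D : Delone.DeloneSet E) {R₂ δ : ℝ}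
    (hR₂ : 2 * D.coveringRadius + 1 ≤ R₂) (hδ : 0 < δ) :
    ∃ c : ℝ, 0 < c ∧ ∀ x ∈ D, ∀ H : Set (E ≃ᵢ E), (∀ g ∈ H, g x = x) → 1 ∈ H →
      (∀ g ∈ H, ∀ p ∈ D, dist p x ≤ R₂ → g p ∈ D) →
      ∃ u : E, dist u x ≤ δ ∧ ∀ g ∈ H, g ≠ 1 → c ≤ dist (g u) u := by
  have hR0 : 0 < R₂ := by linarith [D.coveringRadius.2]
  have hr : (0 : ℝ) < D.packingRadius := D.packingRadius_pos
  obtain ⟨c, hc, h⟩ := exists_uniform_common_vector_of_separated (E := E) (div_pos hr hR0) 2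
  refine ⟨δ * c, by positivity, fun x hx H hHx h1 hH => ?_⟩
  -- Distinct elements of `H` differ at some point of `D` within `R₂` of `x`; its two images lie in
  -- `D`, hence are more than the packing radius apart.
  have hsep : ∀ g ∈ H, ∀ g' ∈ H, g ≠ g' →
      (D.packingRadius : ℝ) / R₂ ≤ ‖g.linearMap - g'.linearMap‖ := by
    intro g hg g' hg' hne
    obtain ⟨p, hp, hpx, hpne⟩ : ∃ p ∈ D, dist p x ≤ R₂ ∧ g p ≠ g' p := by
      by_contra! hcon
      refine hne (IsometryEquiv.eq_of_eqOn (x := x) (T := {p | p ∈ D ∧ dist p x ≤ R₂})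
        (by rw [hHx g hg, hHx g' hg']) (fun p hp => hcon p hp.1 hp.2) fun n hn => ?_)
      obtain ⟨p, hp, hpd, hpn⟩ := D.exists_inner_sub_ne_zero x n hn
      exact ⟨p, ⟨hp, hpd.trans hR₂⟩, hpn⟩
    have h₁ := D.packingRadius_lt_dist_of_mem_ne (hH g hg p hp hpx) (hH g' hg' p hp hpx) hpne
    have h₂ := (g.linearMap - g'.linearMap).le_opNorm (p - x)
    rw [sub_apply, g.linearMap_sub, g'.linearMap_sub, hHx g hg, hHx g' hg',
      sub_sub_sub_cancel_right, ← dist_eq_norm (g p), ← dist_eq_norm p] at h₂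
    rw [div_le_iff₀ hR0]
    exact h₁.le.trans (h₂.trans (by gcongr))
  obtain ⟨w, hw, hcw⟩ := h ((fun g : E ≃ᵢ E => g.linearMap - (1 : E ≃ᵢ E).linearMap) '' (H \ {1}))
    (by
      rintro _ ⟨g, ⟨hg, hg1⟩, rfl⟩
      exact hsep g hg 1 h1 hg1)
    (by
      rintro _ ⟨g, ⟨hg, hg1⟩, rfl⟩
      refine ContinuousLinearMap.opNorm_le_bound _ zero_le_two fun v => ?_
      refine (norm_sub_le _ _).trans ?_
      exact (congrArg₂ (· + ·) (g.norm_linearMap_apply v)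
        (IsometryEquiv.norm_linearMap_apply 1 v)).le.trans_eq (two_mul _).symm)
    (by
      rintro _ ⟨g, ⟨hg, hg1⟩, rfl⟩ _ ⟨g', ⟨hg', hg1'⟩, rfl⟩ hne
      rw [sub_sub_sub_cancel_right]
      exact hsep g hg g' hg' fun h => hne (by rw [h]))
  refine ⟨x + δ • w, ?_, fun g hg hg1 => ?_⟩
  · rw [dist_eq_norm, add_sub_cancel_left, norm_smul, Real.norm_of_nonneg hδ.le]
    exact mul_le_of_le_one_right hδ.le hw
  · have h₁ := hcw _ ⟨g, ⟨hg, hg1⟩, rfl⟩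
    have h₂ : g (x + δ • w) - (x + δ • w) = δ • ((g.linearMap - (1 : E ≃ᵢ E).linearMap) w) := by
      have h₃ := g.linearMap_sub (x + δ • w) x
      have h₄ := (1 : E ≃ᵢ E).linearMap_sub (x + δ • w) x
      rw [add_sub_cancel_left] at h₃ h₄
      rw [← map_smul, sub_apply, h₃, h₄, hHx g hg]
      exact (sub_sub_sub_cancel_right _ _ _).symm
    rw [dist_eq_norm, h₂, norm_smul, Real.norm_of_nonneg hδ.le]
    gcongr

end Isometries

/-! ### Encoding a groupoid in a Delone set -/

section Encoding

/-- Supplies the scales encoding orbits: the continuum has room for all of them, and bounds away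
from `0` and `∞` keep the clusters uniformly discrete and small. -/
theorem exists_injective_Icc_one_two (d : ℕ) : ∃ s : EuclideanSpace ℝ (Fin d) → ℝ,
    Function.Injective s ∧ ∀ x, 1 ≤ s x ∧ s x ≤ 2 := by
  obtain ⟨f, -, hf⟩ := MeasurableSpace.measurable_injection_nat_bool_of_countablySeparated
    (EuclideanSpace ℝ (Fin d))
  have hg : Function.Injective (Cardinal.cantorFunction (1 / 3)) :=
    Cardinal.cantorFunction_injective (by norm_num) (by norm_num)
  have h : Nonempty (EuclideanSpace ℝ (Fin d) ↪ Set.Icc (1 : ℝ) 2) := by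
    rw [← Cardinal.le_def, Cardinal.mk_Icc_real one_lt_two, ← Cardinal.mk_real]
    exact ⟨⟨_, hg.comp hf⟩⟩
  obtain ⟨e⟩ := h
  exact ⟨fun x => e x, Subtype.val_injective.comp e.injective, fun x => (e x).2⟩

/-- Representatives of the orbits of a groupoid. -/
theorem exists_orbit_representative {X G : Type*} [Group G] (S : Set X) (T : X → X → Set G)
    (h1 : ∀ x ∈ S, 1 ∈ T x x) (hinv : ∀ x y, ∀ g ∈ T x y, g⁻¹ ∈ T y x)
    (hmul : ∀ x y z, ∀ g ∈ T x y, ∀ h ∈ T y z, h * g ∈ T x z) :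
    ∃ rep : X → X, (∀ x ∈ S, rep x ∈ S ∧ (T (rep x) x).Nonempty) ∧
      ∀ x ∈ S, ∀ y ∈ S, (T x y).Nonempty → rep x = rep y := by
  classical
  let r : Setoid S := ⟨fun x y => (T x y).Nonempty, fun x => ⟨1, h1 x x.2⟩,
    fun ⟨g, hg⟩ => ⟨g⁻¹, hinv _ _ g hg⟩, fun ⟨g, hg⟩ ⟨h, hh⟩ => ⟨h * g, hmul _ _ _ g hg h hh⟩⟩
  refine ⟨fun x => if hx : x ∈ S then ((Quotient.mk r ⟨x, hx⟩).out : S) else x, ?_, ?_⟩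
  · intro x hx
    simp only [hx, dif_pos]
    exact ⟨Subtype.property _, Quotient.mk_out (s := r) ⟨x, hx⟩⟩
  · intro x hx y hy hxy
    simp only [hx, hy, dif_pos]
    rw [Quotient.sound (s := r) (a := ⟨x, hx⟩) (b := ⟨y, hy⟩) hxy]

/-- Given a Delone set `D₀` in `ℝ^d` and a groupoid `T` of isometries between its points, whose
isotropy groups preserve `D₀` locally, there is a Delone set `D`, the union of finite clusters
`F x` near the points `x` of `D₀`, such that `T` acts on the clusters and every isometry mapping
`D` near `x ∈ D₀` into `D` belongs to `T`. -/
theorem Delone.DeloneSet.exists_encoding {d : ℕ} (hd : 0 < d)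
    (D₀ : Delone.DeloneSet (EuclideanSpace ℝ (Fin d)))
    (T : EuclideanSpace ℝ (Fin d) → EuclideanSpace ℝ (Fin d) → Set (EuclideanGroup d))
    (h1 : ∀ x ∈ D₀, 1 ∈ T x x) (hinv : ∀ x y, ∀ g ∈ T x y, g⁻¹ ∈ T y x)
    (hmul : ∀ x y z, ∀ g ∈ T x y, ∀ h ∈ T y z, h * g ∈ T x z)
    (hT : ∀ x y, ∀ g ∈ T x y, g x = y) {R₂ : ℝ} (hR₂ : 2 * D₀.coveringRadius + 1 ≤ R₂)
    (hstab : ∀ x ∈ D₀, ∀ g ∈ T x x, ∀ p ∈ D₀, dist p x ≤ R₂ → g p ∈ D₀) :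
    ∃ (D : Delone.DeloneSet (EuclideanSpace ℝ (Fin d)))
      (F : EuclideanSpace ℝ (Fin d) → Set (EuclideanSpace ℝ (Fin d))) (ρ : ℝ), 0 ≤ ρ ∧
      (∀ q, q ∈ D ↔ ∃ x ∈ D₀, q ∈ F x) ∧ (∀ x ∈ D₀, ∀ q ∈ F x, dist q x ≤ ρ) ∧
      (∀ x ∈ D₀, ∀ y ∈ D₀, ∀ g ∈ T x y, ∀ q ∈ F x, g q ∈ F y) ∧
      ∀ x ∈ D₀, ∀ z : EuclideanGroup d, (∀ q ∈ D, dist q x ≤ ρ → z q ∈ D) →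
        ∃ y ∈ D₀, z ∈ T x y := by
  have hr : (0 : ℝ) < D₀.packingRadius := D₀.packingRadius_pos
  set r : ℝ := (D₀.packingRadius : ℝ)
  obtain ⟨rep, hrep, hrep'⟩ := exists_orbit_representative {x | x ∈ D₀} T h1 hinv hmul
  obtain ⟨s, hs_inj, hs⟩ := exists_injective_Icc_one_two d
  obtain ⟨K, hKfin, hKnt, hK0, hKspan, hKrigid⟩ := exists_rigid_finite_set hd
  obtain ⟨c₀, hc₀, hmoved⟩ := D₀.exists_uniformly_moved_point hR₂ (δ := r / 4) (by positivity)
  obtain ⟨u, hu⟩ : ∃ u : EuclideanSpace ℝ (Fin d) → EuclideanSpace ℝ (Fin d), ∀ x ∈ D₀,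
      dist (u x) x ≤ r / 4 ∧ ∀ g ∈ T x x, g ≠ 1 → c₀ ≤ dist (g (u x)) (u x) := by
    have : ∀ x, ∃ v, x ∈ D₀ → dist v x ≤ r / 4 ∧ ∀ g ∈ T x x, g ≠ 1 → c₀ ≤ dist (g v) v := by
      intro x
      by_cases hx : x ∈ D₀
      · obtain ⟨v, hv⟩ := hmoved x hx (T x x) (hT x x) (h1 x hx) (hstab x hx)
        exact ⟨v, fun _ => hv⟩
      · exact ⟨0, fun h => absurd h hx⟩
    choose u hu using this
    exact ⟨u, hu⟩
  -- Base points over different points of `D₀` are more than `r - 2 · r / 4` apart, those over the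
  -- same point at least `c₀`.
  set c : ℝ := min c₀ (r / 2)
  have hc : 0 < c := lt_min hc₀ (by positivity)
  have hcc₀ : c ≤ c₀ := min_le_left _ _
  have hcr : c ≤ r / 2 := min_le_right _ _
  obtain ⟨M, hM, hKM⟩ : ∃ M : ℝ, 0 < M ∧ ∀ k ∈ K, ‖k‖ ≤ M := by
    obtain ⟨M, hM⟩ := hKfin.isBounded.exists_norm_le
    exact ⟨max M 1, by positivity, fun k hk => (hM k hk).trans (le_max_left _ _)⟩
  have hm : 0 < K.infsep := hKfin.infsep_pos_iff_nontrivial.2 hKnt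
  -- As `s ≤ 2`, each copy stays within `2εM = c / 8` of its base point.
  set ε : ℝ := c / (16 * M)
  have hε : 0 < ε := by positivity
  let C : EuclideanSpace ℝ (Fin d) → EuclideanSpace ℝ (Fin d) → EuclideanSpace ℝ (Fin d) :=
    fun x k => u x + (ε * s x) • k
  have hεs : ∀ x, 0 < ε * s x := fun x => mul_pos hε (by linarith [(hs x).1])
  have hCdist : ∀ x k k', dist (C x k) (C x k') = ε * s x * dist k k' := fun x k k' => by
    simp only [C, dist_add_left, dist_smul₀, Real.norm_of_nonneg (hεs x).le]
  have hC0 : ∀ x, C x 0 = u x := fun x => by simp [C]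
  have hCu : ∀ x, ∀ k ∈ K, dist (C x k) (u x) ≤ c / 8 := by
    intro x k hk
    rw [← hC0, hCdist, dist_zero_right]
    calc ε * s x * ‖k‖ ≤ ε * 2 * M := by
          gcongr
          exacts [(hs x).2, hKM k hk]
      _ = c / 8 := by simp only [ε]; field_simp; norm_num
  have hφu : ∀ y ∈ D₀, ∀ φ ∈ T (rep y) y, dist (φ (u (rep y))) y ≤ r / 4 := by
    intro y hy φ hφ
    nth_rewrite 2 [← hT _ _ φ hφ]
    rw [φ.dist_eq]
    exact (hu _ (hrep y hy).1).1
  have hbase : ∀ y ∈ D₀, ∀ φ ∈ T (rep y) y, ∀ y' ∈ D₀, ∀ φ' ∈ T (rep y') y',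
      dist (φ (u (rep y))) (φ' (u (rep y'))) < c → y = y' ∧ φ = φ' := by
    intro y hy φ hφ y' hy' φ' hφ' hlt
    by_cases hyy : y = y'
    · subst hyy
      refine ⟨rfl, ?_⟩
      by_contra hne
      have h₁ := (hu _ (hrep y hy).1).2 (φ'⁻¹ * φ) (hmul _ _ _ _ hφ _ (hinv _ _ _ hφ'))
        fun h => hne (inv_mul_eq_one.1 h).symm
      rw [← φ'.dist_eq, IsometryEquiv.mul_apply, IsometryEquiv.apply_inv_self] at h₁
      linarith
    · exfalso
      have h₁ := D₀.packingRadius_lt_dist_of_mem_ne hy hy' hyy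
      have h₂ := dist_triangle4 y (φ (u (rep y))) (φ' (u (rep y'))) y'
      have h₃ := hφu y hy φ hφ
      have h₄ := hφu y' hy' φ' hφ'
      rw [dist_comm] at h₃
      linarith
  -- Using all `φ ∈ T (rep y) y`, rather than a chosen one, makes `F` equivariant under `T`.
  let F : EuclideanSpace ℝ (Fin d) → Set (EuclideanSpace ℝ (Fin d)) :=
    fun y => {q | ∃ φ ∈ T (rep y) y, ∃ k ∈ K, φ (C (rep y) k) = q}
  have hFbase : ∀ y ∈ D₀, ∀ q ∈ F y, dist q y ≤ r / 4 + c / 8 := by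
    rintro y hy _ ⟨φ, hφ, k, hk, rfl⟩
    have h₁ := dist_triangle (φ (C (rep y) k)) (φ (u (rep y))) y
    rw [φ.dist_eq] at h₁
    linarith [hφu y hy φ hφ, hCu (rep y) k hk]
  -- The first term separates points of one copy; points of different copies are at least `c - 2 · c
  -- / 8` apart.
  set p : ℝ := min (ε * K.infsep / 2) (c / 2)
  have hp : 0 < p := by positivity
  have hsep : ∀ q ∈ {q | ∃ x ∈ D₀, q ∈ F x}, ∀ q' ∈ {q | ∃ x ∈ D₀, q ∈ F x}, q ≠ q' →
      p < dist q q' := by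
    rintro _ ⟨y, hy, φ, hφ, k, hk, rfl⟩ _ ⟨y', hy', φ', hφ', k', hk', rfl⟩ hne
    by_cases hlt : dist (φ (u (rep y))) (φ' (u (rep y'))) < c
    · obtain ⟨rfl, rfl⟩ := hbase y hy φ hφ y' hy' φ' hφ' hlt
      have hkk : k ≠ k' := fun h => hne (by rw [h])
      have h₁ := Set.infsep_le_dist_of_mem hk hk' hkk
      rw [φ.dist_eq, hCdist]
      have h₂ : ε * 1 * K.infsep ≤ ε * s (rep y) * dist k k' := by
        gcongr
        exacts [(hεs _).le, (hs _).1]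
      have h₃ : 0 < ε * K.infsep := mul_pos hε hm
      linarith [min_le_left (ε * K.infsep / 2) (c / 2)]
    · have h₁ := dist_triangle4 (φ (u (rep y))) (φ (C (rep y) k)) (φ' (C (rep y') k'))
        (φ' (u (rep y')))
      rw [φ.dist_eq, φ'.dist_eq, dist_comm (u (rep y))] at h₁
      linarith [hCu (rep y) k hk, hCu (rep y') k' hk', min_le_right (ε * K.infsep / 2) (c / 2)]
  let D : Delone.DeloneSet (EuclideanSpace ℝ (Fin d)) :=
    { carrier := {q | ∃ x ∈ D₀, q ∈ F x}
      packingRadius := p.toNNReal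
      packingRadius_pos := Real.toNNReal_pos.2 hp
      isSeparated_packingRadius := by
        intro q hq q' hq' hne
        rw [edist_dist]
        exact (ENNReal.ofReal_lt_ofReal_iff (dist_pos.2 hne)).2 (hsep q hq q' hq' hne)
      coveringRadius := D₀.coveringRadius + D₀.packingRadius
      coveringRadius_pos := add_pos D₀.coveringRadius_pos D₀.packingRadius_pos
      isCover_coveringRadius := by
        rw [isCover_iff_subset_iUnion_closedBall]
        intro x _
        obtain ⟨y, hy, hxy⟩ := D₀.exists_dist_le_coveringRadius x
        obtain ⟨φ, hφ⟩ := (hrep y hy).2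
        refine Set.mem_iUnion₂.2 ⟨φ (u (rep y)), ⟨y, hy, φ, hφ, 0, hK0, by rw [hC0]⟩, ?_⟩
        rw [mem_closedBall, NNReal.coe_add]
        linarith [dist_triangle_right x (φ (u (rep y))) y, hφu y hy φ hφ] }
  refine ⟨D, F, r / 4 + c / 8, by positivity, fun q => Iff.rfl, hFbase, ?_, ?_⟩
  · rintro x hx y hy g hg _ ⟨φ, hφ, k, hk, rfl⟩
    have hxy := hrep' x hx y hy ⟨g, hg⟩
    refine ⟨g * φ, hxy ▸ hmul _ _ _ _ hφ _ hg, k, hk, ?_⟩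
    rw [← hxy, IsometryEquiv.mul_apply]
  · intro x hx z hz
    obtain ⟨φ, hφ⟩ := (hrep x hx).2
    have hzD : ∀ k ∈ K, ∃ y ∈ D₀, ∃ ψ ∈ T (rep y) y, ∃ k' ∈ K,
        ψ (C (rep y) k') = z (φ (C (rep x) k)) := by
      intro k hk
      have hq : φ (C (rep x) k) ∈ F x := ⟨φ, hφ, k, hk, rfl⟩
      exact hz _ ⟨x, hx, hq⟩ (hFbase x hx _ hq)
    obtain ⟨y, hy, ψ, hψ, k₀, hk₀, hzk₀⟩ := hzD 0 hK0
    have hzψ : ∀ k, ∃ k', k ∈ K → k' ∈ K ∧ ψ (C (rep y) k') = z (φ (C (rep x) k)) := by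
      intro k
      by_cases hk : k ∈ K
      swap
      · exact ⟨0, fun h => absurd h hk⟩
      obtain ⟨y', hy', ψ', hψ', k', hk', hzk'⟩ := hzD k hk
      -- The two base points are at most `3c / 8 < c` apart, so the whole image under `z` lies in
      -- the single copy given by `ψ`.
      have h₁ := dist_triangle4 (ψ (u (rep y))) (ψ (C (rep y) k₀)) (ψ' (C (rep y') k'))
        (ψ' (u (rep y')))
      have h₂ := hCu (rep x) k hk
      rw [ψ.dist_eq, ψ'.dist_eq, hzk₀, hzk', z.dist_eq, φ.dist_eq, hC0, dist_comm (u (rep y)),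
        dist_comm (u (rep x))] at h₁
      obtain ⟨rfl, rfl⟩ := hbase y hy ψ hψ y' hy' ψ' hψ'
        (by linarith [hCu (rep y) k₀ hk₀, hCu (rep y') k' hk'])
      exact ⟨k', fun _ => ⟨hk', hzk'⟩⟩
    choose f hf using hzψ
    have hεy := hεs (rep y)
    have hsx : 0 < s (rep x) := by linarith [(hs (rep x)).1]
    have hsy : 0 < s (rep y) := by linarith [(hs (rep y)).1]
    obtain ⟨hl, hfix⟩ := hKrigid f (s (rep x) / s (rep y)) (by positivity)
      (fun k hk => (hf k hk).1) (by
        intro k hk k' hk'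
        have h₁ := hCdist (rep y) (f k) (f k')
        rw [← ψ.dist_eq, (hf k hk).2, (hf k' hk').2, z.dist_eq, φ.dist_eq, hCdist] at h₁
        field_simp
        rw [mul_assoc, mul_assoc] at h₁
        linarith [mul_left_cancel₀ hε.ne' h₁])
    -- Equal scales mean equal orbits, by injectivity of `s`.
    have hxy : rep x = rep y := hs_inj ((div_eq_one_iff_eq hsy.ne').1 hl)
    have hzφ : z * φ = ψ := by
      have hag : ∀ k ∈ K, (z * φ) (C (rep x) k) = ψ (C (rep x) k) := by
        intro k hk
        have := (hf k hk).2
        rw [hfix k hk, ← hxy] at this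
        exact this.symm
      refine IsometryEquiv.eq_of_eqOn (x := C (rep x) 0) (T := C (rep x) '' K) (hag 0 hK0) ?_ ?_
      · rintro _ ⟨k, hk, rfl⟩
        exact hag k hk
      · intro n hn
        obtain ⟨k, hk, hkn⟩ := hKspan n hn
        refine ⟨_, ⟨k, hk, rfl⟩, ?_⟩
        rw [hC0]
        simp only [C, add_sub_cancel_left, inner_smul_right]
        exact mul_ne_zero (hεs _).ne' hkn
    refine ⟨y, hy, ?_⟩
    rw [eq_mul_inv_of_mul_eq hzφ]
    exact hmul _ _ _ _ (hinv _ _ _ hφ) _ (hxy ▸ hψ)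

end Encoding

/-! ### Order, supports and gluing of patterns -/

namespace AbstractPatternSpace

section Order

variable {X : Type*} [TopologicalSpace X] {Pat : Type*} [AbstractPatternSpace X Pat]

theorem supp_cut_le (P : Pat) (C : Closeds X) : supp X (cut P C) ≤ C := by
  rw [← cut_eq_self_iff, cut_cut, inf_idem]

theorem supp_cut_le_supp (P : Pat) (C : Closeds X) : supp X (cut P C) ≤ supp X P := by
  rw [← cut_eq_self_iff, cut_cut, inf_comm, ← cut_cut, (cut_eq_self_iff X P _).2 le_rfl]

theorem Majorizes.supp_le {P Q : Pat} (h : Majorizes X P Q) : supp X Q ≤ supp X P := by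
  have := supp_cut_le_supp P (supp X Q)
  rwa [show cut P (supp X Q) = Q from h] at this

theorem majorizes_cut (P : Pat) (C : Closeds X) : Majorizes X P (cut P C) := by
  have h : C ⊓ supp X (cut P C) = supp X (cut P C) := inf_eq_right.2 (supp_cut_le P C)
  rw [Majorizes, ← h, ← cut_cut]
  exact (cut_eq_self_iff X _ _).2 le_rfl

theorem Majorizes.antisymm {P Q : Pat} (h : Majorizes X P Q) (h' : Majorizes X Q P) : P = Q := by
  have h₁ : cut P (supp X Q) = P := (cut_eq_self_iff X P _).2 h'.supp_le
  exact h₁.symm.trans h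

theorem cut_eq_cut_of_le {P Q : Pat} {C C' : Closeds X} (h : cut P C = cut Q C) (hC : C' ≤ C) :
    cut P C' = cut Q C' := by
  rw [← inf_eq_right.2 hC, ← cut_cut, h, cut_cut]

end Order

section Action

variable {Γ X Pat : Type*} [Group Γ] [TopologicalSpace X] [MulAction Γ X]
  [ContinuousConstSMul Γ X] [AbstractPatternSpace X Pat] [MulAction Γ Pat]
  [EquivariantPatternSpace Γ X Pat]

theorem smulClosed_le_iff (γ : Γ) (C C' : Closeds X) :
    smulClosed γ C ≤ smulClosed γ C' ↔ C ≤ C' :=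
  Set.image_subset_image_iff (MulAction.injective γ)

theorem smulClosed_smulClosed_inv (γ : Γ) (C : Closeds X) :
    smulClosed γ (smulClosed γ⁻¹ C) = C := by
  ext x
  simp [smulClosed]

theorem supp_smul (γ : Γ) (P : Pat) : supp X (γ • P) = smulClosed γ (supp X P) := by
  have key : ∀ C : Closeds X, supp X (γ • P) ≤ smulClosed γ C ↔
      smulClosed γ (supp X P) ≤ smulClosed γ C := by
    intro C
    rw [← cut_eq_self_iff, EquivariantPatternSpace.smul_cut_smul, smul_left_cancel_iff,
      cut_eq_self_iff, smulClosed_le_iff]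
  apply le_antisymm
  · exact (key _).2 le_rfl
  · have := key (smulClosed γ⁻¹ (supp X (γ • P)))
    rw [smulClosed_smulClosed_inv] at this
    exact this.1 le_rfl

theorem Majorizes.smul {P Q : Pat} (h : Majorizes X P Q) (γ : Γ) :
    Majorizes X (γ • P) (γ • Q) := by
  rw [Majorizes, supp_smul, EquivariantPatternSpace.smul_cut_smul]
  exact congrArg _ h

end Action

section Metric

variable {X : Type*} [MetricSpace X] {Pat : Type*} [AbstractPatternSpace X Pat]

theorem closedBallC_le {x y : X} {r s : ℝ} (h : dist x y + r ≤ s) :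
    closedBallC x r ≤ closedBallC y s :=
  closedBall_subset_closedBall' (by rw [add_comm]; exact h)

/-- A pattern consisting of bounded components is the only possible supremum of its restrictions to
large balls centered at a relatively dense set. -/
theorem IsSupremum.eq_of_cut_closedBall {P T : Pat} {R Rb Rc : ℝ}
    (hb : ∀ (C : Closeds X) (x : X), x ∈ supp X (cut P C) →
      x ∈ supp X (cut (cut P C) (closedBallC x Rb)))
    {A : Set X} (hA : ∀ x, ∃ y ∈ A, dist x y ≤ Rc) (hR : Rc + Rb ≤ R)
    (hS : IsSupremum X ((fun x => cut P (closedBallC x R)) '' A) T) :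
    T = P := by
  have hPT : Majorizes X P T := hS.2 P (by
    rintro _ ⟨x, -, rfl⟩
    exact majorizes_cut P _)
  -- Bounded components keep each support point `x` in the support of the restriction to `B(x, Rb)`,
  -- which lies in a ball around some `y ∈ A`.
  have hsupp : supp X P ≤ supp X T := by
    intro x hx
    obtain ⟨y, hy, hxy⟩ := hA x
    have h₁ : cut P (⊤ : Closeds X) = P := (cut_eq_self_iff X P _).2 le_top
    have h₂ := hb ⊤ x (by rwa [h₁])
    rw [h₁, ← inf_eq_right.2 (closedBallC_le (show dist x y + Rb ≤ R by linarith)), ← cut_cut] at h₂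
    have h₃ : Majorizes X T (cut P (closedBallC y R)) := hS.1 _ ⟨y, hy, rfl⟩
    exact h₃.supp_le (supp_cut_le_supp _ _ h₂)
  have h₁ : cut P (supp X T) = P := (cut_eq_self_iff X P _).2 hsupp
  exact hPT.symm.trans h₁

theorem cut_closedBallC_eq_of_disjoint (P : Pat) {x z : X} {r s : ℝ} (h : r + s < dist x z) :
    cut (cut P (closedBallC x r)) (closedBallC z s) = cut P (⊥ : Closeds X) := by
  rw [cut_cut]
  congr 1
  exact SetLike.coe_injective (closedBall_disjoint_closedBall h).inter_eq

variable (X Pat) in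
/-- In a glueable abstract pattern space there is only one pattern with empty support. -/
theorem Glueable.cut_bot (h : Glueable X Pat) (P Q : Pat) :
    cut P (⊥ : Closeds X) = cut Q (⊥ : Closeds X) := by
  -- The supremum of the empty family is a least element.
  obtain ⟨S, hS⟩ := h.1 ∅ (by intro x r _; simp) (by intro P hP; simp at hP)
  have h₁ : ∀ T : Pat, Majorizes X T S := fun T => hS.2 T (by simp)
  have hS0 : supp X S = ⊥ := le_bot_iff.1 ((h₁ (cut S (⊥ : Closeds X))).supp_le.trans (supp_cut_le S ⊥))
  have h₂ : ∀ T : Pat, cut T (⊥ : Closeds X) = S := fun T => hS0 ▸ h₁ T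
  rw [h₂, h₂]

/-- In a glueable abstract pattern space, a pattern consisting of bounded components is glued from
its restrictions to large balls centered at a Delone set, compatibly with cutting off. -/
theorem Glueable.isSupremum_cut_closedBall (h : Glueable X Pat) {P : Pat} {R Rb : ℝ}
    (hb : ∀ (C : Closeds X) (x : X), x ∈ supp X (cut P C) →
      x ∈ supp X (cut (cut P C) (closedBallC x Rb)))
    (A : Set X) (hAfin : ∀ z r, (A ∩ closedBall z r).Finite) {Rc : ℝ}
    (hA : ∀ x, ∃ y ∈ A, dist x y ≤ Rc) (hR : Rc + Rb ≤ R) (C : Closeds X) :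
    IsSupremum X ((fun x => cut (cut P (closedBallC x R)) C) '' A) (cut P C) := by
  set Ξ : Set Pat := (fun x => cut P (closedBallC x R)) '' A with hΞ
  have hlf : LocallyFinitePatterns X Ξ := by
    intro z r _
    -- All balls missing `B(z, r)` contribute the same pattern `cut P ⊥`.
    refine (((hAfin z (R + r)).image
      fun x => cut (cut P (closedBallC x R)) (closedBallC z r)).insert (cut P (⊥ : Closeds X))).subset ?_
    rintro _ ⟨_, ⟨x, hx, rfl⟩, rfl⟩
    by_cases hxz : dist x z ≤ R + r
    · exact Or.inr ⟨x, ⟨hx, hxz⟩, rfl⟩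
    · exact Or.inl (cut_closedBallC_eq_of_disjoint P (not_le.1 hxz))
  have hpc : PairwiseCompatible X Ξ := by
    rintro _ ⟨x, -, rfl⟩ _ ⟨y, -, rfl⟩
    exact ⟨P, majorizes_cut P _, majorizes_cut P _⟩
  obtain ⟨S, hS⟩ := h.1 Ξ hlf hpc
  have hSP : S = P := IsSupremum.eq_of_cut_closedBall hb hA hR hS
  have := h.2 Ξ hlf hpc C S hS
  rwa [hΞ, Set.image_image, hSP] at this

end Metric

end AbstractPatternSpace

open AbstractPatternSpace

theorem Delone.DeloneSet.finite_inter_closedBall {X : Type*} [MetricSpace X] [ProperSpace X]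
    (D : Delone.DeloneSet X) (z : X) (r : ℝ) : ({x | x ∈ D} ∩ closedBall z r).Finite := by
  have hp : (0 : ℝ) < D.packingRadius := D.packingRadius_pos
  obtain ⟨t, -, ht, hcov⟩ := finite_cover_balls_of_compact (isCompact_closedBall z r) (half_pos hp)
  refine (ht.biUnion (t := fun y => {x | x ∈ D} ∩ ball y (D.packingRadius / 2)) fun y _ => ?_).subset ?_
  · refine Set.Subsingleton.finite fun a ha b hb => ?_
    by_contra hne
    have h₁ := D.packingRadius_lt_dist_of_mem_ne ha.1 hb.1 hne
    have h₂ := dist_triangle_right a b y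
    linarith [mem_ball.1 ha.2, mem_ball.1 hb.2]
  · rintro x ⟨hx, hxz⟩
    obtain ⟨y, hy, hxy⟩ := Set.mem_iUnion₂.1 (hcov hxz)
    exact Set.mem_iUnion₂.2 ⟨y, hy, hx, hxy⟩

/-! ### Local derivability of Delone sets -/

section

variable {Γ X Pat : Type*} [Group Γ] [MetricSpace X] [MulAction Γ X] [IsIsometricSMul Γ X]
  [AbstractPatternSpace X Pat] [MulAction Γ Pat] [EquivariantPatternSpace Γ X Pat]

theorem smulClosed_closedBallC (γ : Γ) (x : X) (r : ℝ) :
    smulClosed γ (closedBallC x r) = closedBallC (γ • x) r :=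
  SetLike.coe_injective ((Set.image_smul (a := γ)).trans (smul_closedBall γ x r))

theorem smul_cut_closedBallC (γ : Γ) (P : Pat) (x : X) (r : ℝ) :
    γ • cut P (closedBallC x r) = cut (γ • P) (closedBallC (γ • x) r) := by
  rw [← smulClosed_closedBallC, EquivariantPatternSpace.smul_cut_smul]

theorem Delone.DeloneSet.cut_smul_toUD_eq_iff (D : Delone.DeloneSet X) (γ η : Γ)
    (C : Closeds X) : cut (γ • D.toUD) C = cut (η • D.toUD) C ↔
      ∀ q ∈ C, (∃ p ∈ D, γ • p = q) ↔ ∃ p ∈ D, η • p = q := by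
  rw [UDSet.ext_iff, Set.ext_iff]
  change (∀ q, q ∈ (γ • ·) '' D.carrier ∩ C ↔ q ∈ (η • ·) '' D.carrier ∩ C) ↔ _
  refine forall_congr' fun q => ?_
  change ((∃ p ∈ D, γ • p = q) ∧ q ∈ C ↔ (∃ p ∈ D, η • p = q) ∧ q ∈ C) ↔ _
  exact and_congr_left_iff

end

section

variable {d : ℕ} {Γ : Subgroup (EuclideanGroup d)} {Pat : Type*}
  [AbstractPatternSpace (EuclideanSpace ℝ (Fin d)) Pat] [MulAction Γ Pat]
  [EquivariantPatternSpace Γ (EuclideanSpace ℝ (Fin d)) Pat]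

/-- If `Γ` contains the translations, the centers in the definition of local derivability
can be moved to any common point. -/
theorem AbstractPatternSpace.LocallyDerivable.exists_radius
    (htrans : EuclideanGroup.ContainsTranslations Γ) {P : Pat}
    {D : Delone.DeloneSet (EuclideanSpace ℝ (Fin d))}
    (h : LocallyDerivable Γ (EuclideanSpace ℝ (Fin d)) (EuclideanSpace ℝ (Fin d)) P D.toUD) :
    ∃ R₀ : ℝ, 0 ≤ R₀ ∧ ∀ (z : EuclideanSpace ℝ (Fin d)) (γ η : Γ) (R : ℝ), 0 ≤ R →
      cut (γ • P) (closedBallC z (R + R₀)) = cut (η • P) (closedBallC z (R + R₀)) →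
      ∀ q ∈ D, dist (γ • q) z ≤ R → ∃ p ∈ D, η • p = γ • q := by
  obtain ⟨x₀, y₀, R₀, hR₀, h⟩ := h
  refine ⟨R₀ + dist x₀ y₀, by positivity, fun z γ η R hR heq q hq hqz => ?_⟩
  let τ : Γ := ⟨IsometryEquiv.constVAdd (x₀ - z), htrans _⟩
  have hτ : τ • z = x₀ := sub_add_cancel x₀ z
  have h₁ := h (τ * γ) (τ * η) (R + dist x₀ y₀) (by positivity) (by
    rw [← hτ, mul_smul, mul_smul, ← smul_cut_closedBallC, ← smul_cut_closedBallC, hτ,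
      show R + dist x₀ y₀ + R₀ = R + (R₀ + dist x₀ y₀) by ring, heq])
  rw [Delone.DeloneSet.cut_smul_toUD_eq_iff] at h₁
  have hmem : (τ * γ) • q ∈ closedBallC y₀ (R + dist x₀ y₀) := by
    change dist ((τ * γ) • q) y₀ ≤ _
    refine (dist_triangle _ x₀ _).trans ?_
    nth_rewrite 1 [← hτ]
    rw [mul_smul, dist_smul]
    linarith
  obtain ⟨p, hp, hpq⟩ := (h₁ _ hmem).1 ⟨q, hq, rfl⟩
  rw [mul_smul, mul_smul, smul_left_cancel_iff] at hpq
  exact ⟨p, hp, hpq⟩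

end

/-! ### The groupoid of patch-preserving isometries -/

section

variable {d : ℕ} {Γ : Subgroup (EuclideanGroup d)} {Pat : Type*}
  [AbstractPatternSpace (EuclideanSpace ℝ (Fin d)) Pat] [MulAction Γ Pat]

variable (Γ) in
/-- The isometries in `Γ` mapping `x` to `y` and the patch of `P` of radius `r` around `x` to the
one around `y`. -/
def patchMaps (P : Pat) (r : ℝ) (x y : EuclideanSpace ℝ (Fin d)) : Set (EuclideanGroup d) :=
  {g | g x = y ∧ ∃ h : g ∈ Γ, (⟨g, h⟩ : Γ) • cut P (closedBallC x r) = cut P (closedBallC y r)}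

theorem one_mem_patchMaps (P : Pat) (r : ℝ) (x : EuclideanSpace ℝ (Fin d)) :
    1 ∈ patchMaps Γ P r x x :=
  ⟨rfl, Γ.one_mem, one_smul Γ _⟩

theorem inv_mem_patchMaps {P : Pat} {r : ℝ} {x y : EuclideanSpace ℝ (Fin d)}
    {g : EuclideanGroup d} (hg : g ∈ patchMaps Γ P r x y) : g⁻¹ ∈ patchMaps Γ P r y x := by
  obtain ⟨rfl, hg, h⟩ := hg
  exact ⟨g.inv_apply_self x, Γ.inv_mem hg, (inv_smul_eq_iff (g := (⟨g, hg⟩ : Γ))).2 h.symm⟩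

theorem mul_mem_patchMaps {P : Pat} {r : ℝ} {x y z : EuclideanSpace ℝ (Fin d)}
    {g k : EuclideanGroup d} (hg : g ∈ patchMaps Γ P r x y) (hk : k ∈ patchMaps Γ P r y z) :
    k * g ∈ patchMaps Γ P r x z := by
  obtain ⟨rfl, hg, h⟩ := hg
  obtain ⟨rfl, hk, h'⟩ := hk
  refine ⟨rfl, Γ.mul_mem hk hg, ?_⟩
  rw [← h', ← h]
  exact mul_smul (⟨k, hk⟩ : Γ) (⟨g, hg⟩ : Γ) _

variable [EquivariantPatternSpace Γ (EuclideanSpace ℝ (Fin d)) Pat]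

theorem inv_mul_mem_patchMaps_iff {P : Pat} {r : ℝ} {x y : EuclideanSpace ℝ (Fin d)} {γ η : Γ} :
    ((η⁻¹ * γ : Γ) : EuclideanGroup d) ∈ patchMaps Γ P r x y ↔ η • y = γ • x ∧
      cut (γ • P) (closedBallC (γ • x) r) = cut (η • P) (closedBallC (η • y) r) := by
  have h₁ : ((η⁻¹ * γ : Γ) : EuclideanGroup d) x = y ↔ η • y = γ • x := by
    change (η⁻¹ * γ) • x = y ↔ _
    rw [mul_smul, inv_smul_eq_iff, eq_comm]
  have h₂ : (η⁻¹ * γ) • cut P (closedBallC x r) = cut P (closedBallC y r) ↔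
      cut (γ • P) (closedBallC (γ • x) r) = cut (η • P) (closedBallC (η • y) r) := by
    rw [mul_smul, inv_smul_eq_iff, smul_cut_closedBallC, smul_cut_closedBallC]
  exact and_congr h₁ ⟨fun ⟨_, h⟩ => h₂.1 h, fun h => ⟨(η⁻¹ * γ).2, h₂.2 h⟩⟩

end

/-! ### Mutual local derivability -/

theorem mainTheorem2 (d : ℕ) (hd : 0 < d) (Γ : Subgroup (EuclideanGroup d))
    (hclosed : EuclideanGroup.IsClosedSubgroup Γ)
    (htrans : EuclideanGroup.ContainsTranslations Γ)
    (Pat : Type u) [AbstractPatternSpace (EuclideanSpace ℝ (Fin d)) Pat] [MulAction Γ Pat]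
    [EquivariantPatternSpace Γ (EuclideanSpace ℝ (Fin d)) Pat]
    (hglue : AbstractPatternSpace.Glueable (EuclideanSpace ℝ (Fin d)) Pat)
    (P : Pat)
    (hbdd : AbstractPatternSpace.ConsistsOfBoundedComponents (EuclideanSpace ℝ (Fin d)) P)
    (hdel : AbstractPatternSpace.DeloneDeriving Γ (EuclideanSpace ℝ (Fin d)) P) :
    ∃ D : Delone.DeloneSet (EuclideanSpace ℝ (Fin d)),
      AbstractPatternSpace.MutuallyLocallyDerivable Γ (EuclideanSpace ℝ (Fin d)) (EuclideanSpace ℝ (Fin d))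
        P D.toUD := by
  obtain ⟨Rb, hRb, hb⟩ := hbdd
  obtain ⟨D₀, hD₀⟩ := hdel
  obtain ⟨R₀, hR₀, hD₀⟩ := hD₀.exists_radius htrans
  have hRc : (0 : ℝ) ≤ D₀.coveringRadius := D₀.coveringRadius.coe_nonneg
  -- `2 * D₀.coveringRadius + 1` makes `D₀` span near each point, `Rb` makes the patches large
  -- enough to glue; in `R₁`, the extra `R₀` lets a patch determine `D₀` up to `R₂`.
  set R₂ : ℝ := 2 * D₀.coveringRadius + 1 + Rb with hR₂
  set R₁ : ℝ := R₂ + R₀ with hR₁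
  obtain ⟨D, F, ρ, hρ, hDF, hFρ, hFmap, hrec⟩ := D₀.exists_encoding hd (patchMaps Γ P R₁)
    (fun x _ => one_mem_patchMaps P R₁ x) (fun _ _ _ => inv_mem_patchMaps)
    (fun _ _ _ _ hg _ hk => mul_mem_patchMaps hg hk) (fun _ _ _ hg => hg.1)
    (R₂ := R₂) (by linarith) (by
      rintro x hx g ⟨hgx, hg, hgP⟩ p hp hpx
      have hx' : (⟨g, hg⟩ : Γ) • x = x := hgx
      rw [smul_cut_closedBallC, hx'] at hgP
      obtain ⟨q, hq, hqp⟩ := hD₀ x ⟨g, hg⟩ 1 R₂ (by positivity) (by rw [hgP, one_smul]) p hp (by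
        rwa [← hx', dist_smul])
      rw [one_smul] at hqp
      rwa [hqp] at hq)
  -- Towards `D`: `ρ` passes from a cluster point to its center, `R₀` matches centers, `R₁` compares
  -- patches. Back: patches meeting `B(0, R)` have centers within `R + R₁`, and their clusters add
  -- `ρ`.
  refine ⟨D, ⟨0, 0, R₀ + R₁ + ρ, by positivity, ?_⟩, 0, 0, R₁ + ρ, by positivity, ?_⟩
  · have key : ∀ (γ η : Γ) (R : ℝ), 0 ≤ R →
        cut (γ • P) (closedBallC (0 : EuclideanSpace ℝ (Fin d)) (R + (R₀ + R₁ + ρ))) =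
          cut (η • P) (closedBallC (0 : EuclideanSpace ℝ (Fin d)) (R + (R₀ + R₁ + ρ))) →
        ∀ q ∈ D, dist (γ • q) 0 ≤ R → ∃ p ∈ D, η • p = γ • q := by
      intro γ η R hR heq q hq hqR
      obtain ⟨x, hx, hqx⟩ := (hDF q).1 hq
      have hγx : dist (γ • x) 0 ≤ R + ρ := by
        have h₁ := dist_triangle_left (γ • x) 0 (γ • q)
        rw [dist_smul] at h₁
        linarith [hFρ x hx q hqx]
      obtain ⟨y, hy, hyx⟩ := hD₀ 0 γ η (R + ρ) (by positivity)
        (cut_eq_cut_of_le heq (closedBallC_le (by rw [dist_self]; linarith))) x hx hγx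
      have hmem : ((η⁻¹ * γ : Γ) : EuclideanGroup d) ∈ patchMaps Γ P R₁ x y := by
        rw [inv_mul_mem_patchMaps_iff, hyx]
        exact ⟨rfl, cut_eq_cut_of_le heq (closedBallC_le (by linarith))⟩
      refine ⟨(η⁻¹ * γ) • q, (hDF _).2 ⟨y, hy, hFmap x hx y hy _ hmem q hqx⟩, ?_⟩
      rw [mul_smul, smul_inv_smul]
    intro γ η R hR heq
    rw [Delone.DeloneSet.cut_smul_toUD_eq_iff]
    intro q hq
    constructor
    · rintro ⟨p, hp, rfl⟩
      exact key γ η R hR heq p hp hq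
    · rintro ⟨p, hp, rfl⟩
      exact key η γ R hR heq.symm p hp hq
  · have key : ∀ (γ η : Γ) (R : ℝ), 0 ≤ R →
        cut (γ • D.toUD) (closedBallC (0 : EuclideanSpace ℝ (Fin d)) (R + (R₁ + ρ))) =
          cut (η • D.toUD) (closedBallC (0 : EuclideanSpace ℝ (Fin d)) (R + (R₁ + ρ))) →
        Majorizes (EuclideanSpace ℝ (Fin d)) (cut (η • P) (closedBallC (0 : EuclideanSpace ℝ (Fin d)) R))
          (cut (γ • P) (closedBallC (0 : EuclideanSpace ℝ (Fin d)) R)) := by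
      intro γ η R hR heq
      rw [Delone.DeloneSet.cut_smul_toUD_eq_iff] at heq
      have hsup := hglue.isSupremum_cut_closedBall (R := R₁) hb {x | x ∈ D₀}
        D₀.finite_inter_closedBall D₀.exists_dist_le_coveringRadius (by linarith)
        (closedBallC (γ⁻¹ • (0 : EuclideanSpace ℝ (Fin d))) R)
      have h := (hsup.2 (γ⁻¹ • cut (η • P) (closedBallC (0 : EuclideanSpace ℝ (Fin d)) R)) ?_).smul γ
      · rwa [smul_inv_smul, smul_cut_closedBallC, smul_inv_smul] at h
      rintro _ ⟨x, hx, rfl⟩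
      have hpatch : Majorizes (EuclideanSpace ℝ (Fin d)) (cut (η • P) (closedBallC (0 : EuclideanSpace ℝ (Fin d)) R))
          (cut (cut (γ • P) (closedBallC (γ • x) R₁)) (closedBallC (0 : EuclideanSpace ℝ (Fin d)) R)) := by
        -- A patch missing the ball leaves the unique empty pattern; otherwise `D` near `x` forces
        -- `η⁻¹ * γ` into the groupoid.
        by_cases hfar : R₁ + R < dist (γ • x) 0
        · rw [cut_closedBallC_eq_of_disjoint _ hfar,
            hglue.cut_bot _ _ _ (cut (η • P) (closedBallC (0 : EuclideanSpace ℝ (Fin d)) R))]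
          exact majorizes_cut _ _
        · obtain ⟨y, hy, hmem⟩ := hrec x hx ((η⁻¹ * γ : Γ) : EuclideanGroup d) (by
            intro q hq hqx
            have h₁ := dist_triangle (γ • q) (γ • x) 0
            rw [dist_smul] at h₁
            obtain ⟨p, hp, hpq⟩ := (heq (γ • q) (show dist (γ • q) 0 ≤ _ by linarith)).1
              ⟨q, hq, rfl⟩
            change (η⁻¹ * γ) • q ∈ D
            rwa [mul_smul, ← hpq, inv_smul_smul])
          rw [(inv_mul_mem_patchMaps_iff.1 hmem).2, cut_cut, inf_comm, ← cut_cut]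
          exact majorizes_cut _ _
      have h := hpatch.smul γ⁻¹
      rwa [smul_cut_closedBallC γ⁻¹ (cut _ _), ← smul_cut_closedBallC γ P, inv_smul_smul] at h
    intro γ η R hR heq
    exact (key η γ R hR heq.symm).antisymm (key γ η R hR heq)
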